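/- Let $\mathfrak{g}$ be a finite-dimensional complex simple Lie algebra with Cartan subalgebra $\mathfrak{h}$, root system $\Phi$ and simple roots $\alpha_1,\dots,\alpha_n$. Let $h_{\alpha_i}\in\mathfrak{h}$ be the coroot of $\alpha_i$, and for each $\alpha\in\Phi$ let $E_\alpha$ be a nonzero root vector for $\alpha$. For a finite-dimensional representation $\phi$ of $\mathfrak{g}$ put $$f_\phi=\det\Big(z_0I+\sum_{i=1}^n z_i\,\phi(h_{\alpha_i})+\sum_{\alpha\in\Phi}z_\alpha\,\phi(E_\alpha)\Big),\qquad \tilde f_\phi=\det\Big(z_0I+\sum_{i=1}^n z_i\,\phi(h_{\alpha_i})\Big),$$ and let $\mathbf{CP}_{\mathfrak{g}}=\{f_\phi\}_\phi$ and $\widetilde{\mathbf{CP}_{\mathfrak{g}}}=\{\tilde f_\phi\}_\phi$, where $\phi$ runs over all finite-dimensional representations of $\mathfrak{g}$. Let $\rho$ be the linearization map, which sets all variables $z_\alpha$ $(\alpha\in\Phi)$ to $0$, so that $\rho(f_\phi)=\tilde f_\phi$. For representations $\phi,\varphi$ with sets of weights $\Gamma_\phi,\Gamma_\varphi$ (with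 respect to $\mathfrak{h}$) and weight multiplicities $d_\lambda$ $(\lambda\in\Gamma_\phi)$, $d_\mu$ $(\mu\in\Gamma_\varphi)$, the resolution product of $\tilde f_\phi$ and $\tilde f_\varphi$ is $$\tilde f_\phi*\tilde f_\varphi=\prod_{\lambda\in\Gamma_\phi,\ \mu\in\Gamma_\varphi}\Big(z_0+\sum_{i=1}^n\big(\lambda(h_{\alpha_i})+\mu(h_{\alpha_i})\big)z_i\Big)^{d_\lambda d_\mu}.$$ Then this is a well-defined operation on $\widetilde{\mathbf{CP}_{\mathfrak{g}}}$, which makes $\widetilde{\mathbf{CP}_{\mathfrak{g}}}$ a commutative monoid with unit element $z_0$. The map $\rho:\mathbf{CP}_{\mathfrak{g}}\to\widetilde{\mathbf{CP}_{\mathfrak{g}}}$ is a bijection. Under the resolution product $$f_\phi*f_\varphi=\rho^{-1}\big(\tilde f_\phi*\tilde f_\varphi\big),$$ $\mathbf{CP}_{\mathfrak{g}}$ is a commutative monoid with unit element $z_0$, and $f_\phi*f_\varphi=f_{\phi\otimes\varphi}$ for all finite-dimensional representations $\phi,\varphi$ of $\mathfrak{g}$. Furthermore, $\rho$ is an isomorphism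 of monoids from $\mathbf{CP}_{\mathfrak{g}}$ to $\widetilde{\mathbf{CP}_{\mathfrak{g}}}$. -/

import Mathlib

open scoped TensorProduct

universe u v

noncomputable section

namespace LieCharPoly

open MvPolynomial LieAlgebra LieModule

section General

variable {L : Type u} [LieRing L] [LieAlgebra ℂ L]

/-- For a finite family `x` of elements of a complex Lie algebra `L` and a finite-dimensional
representation `V` of `L` with action `φ`, the polynomial `det (z₀ I + ∑ i, zᵢ φ (x i))` in the
indeterminates `z₀` (the variable `none`) and `zᵢ` (the variable `some i`). The determinant is that
of an endomorphism of the free module `ℂ[z] ⊗ V` over the polynomial ring `ℂ[z]`. -/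
def pencilDet {σ : Type*} [Fintype σ] (x : σ → L) (V : Type v) [AddCommGroup V] [Module ℂ V]
    [LieRingModule L V] [LieModule ℂ L V] : MvPolynomial (Option σ) ℂ :=
  LinearMap.det
    ((X none : MvPolynomial (Option σ) ℂ) •
        (LinearMap.id : MvPolynomial (Option σ) ℂ ⊗[ℂ] V →ₗ[MvPolynomial (Option σ) ℂ]
          MvPolynomial (Option σ) ℂ ⊗[ℂ] V) +
      ∑ i : σ, (X (some i) : MvPolynomial (Option σ) ℂ) •
        (toEnd ℂ L V (x i)).baseChange (MvPolynomial (Option σ) ℂ))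

end General

variable {L : Type u} [LieRing L] [LieAlgebra ℂ L] [FiniteDimensional ℂ L] [IsSimple ℂ L]
  {H : LieSubalgebra ℂ L} [H.IsCartanSubalgebra]

/-- The elements `h_α` of the Cartan subalgebra for `α` in a base of simple roots: the coroots. -/
def simpleCoroot (b : (IsKilling.rootSystem H).Base) (i : b.support) : H :=
  (IsKilling.rootSystem H).coroot i

/-- The canonical basis of `L`, consisting of the `h_α` for `α` simple and of the chosen root
vectors `e α` for `α` a root. -/
def canonicalFamily (b : (IsKilling.rootSystem H).Base) (e : H.root → L) :
    b.support ⊕ H.root → L :=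
  Sum.elim (fun i => (simpleCoroot b i : L)) e

/-- The characteristic polynomial `f_φ` of a representation, relative to the canonical basis. -/
def charPoly (b : (IsKilling.rootSystem H).Base) (e : H.root → L)
    (V : Type v) [AddCommGroup V] [Module ℂ V] [LieRingModule L V] [LieModule ℂ L V] :
    MvPolynomial (Option (b.support ⊕ H.root)) ℂ :=
  pencilDet (canonicalFamily b e) V

/-- The linearized polynomial of a representation: `det (z₀ I + ∑ i, zᵢ φ (h_{αᵢ}))`. -/
def linCharPoly (b : (IsKilling.rootSystem H).Base)
    (V : Type v) [AddCommGroup V] [Module ℂ V] [LieRingModule L V] [LieModule ℂ L V] :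
    MvPolynomial (Option b.support) ℂ :=
  pencilDet (fun i => (simpleCoroot b i : L)) V

/-- Linearization of polynomials: `p(z₀, …, zₙ, z_α …) ↦ p(z₀, …, zₙ, 0, …, 0)`, i.e. the variables
that belong to root vectors are set to `0`. -/
def linearize (b : (IsKilling.rootSystem H).Base) :
    MvPolynomial (Option (b.support ⊕ H.root)) ℂ →ₐ[ℂ] MvPolynomial (Option b.support) ℂ :=
  aeval fun j => match j with
    | none => X none
    | some (Sum.inl i) => X (some i)
    | some (Sum.inr _) => 0

/-- The set of the characteristic polynomials of all finite-dimensional representations. -/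
def CP (b : (IsKilling.rootSystem H).Base) (e : H.root → L) :
    Set (MvPolynomial (Option (b.support ⊕ H.root)) ℂ) :=
  {p | ∃ (V : Type v) (_ : AddCommGroup V) (_ : Module ℂ V) (_ : LieRingModule L V)
    (_ : LieModule ℂ L V) (_ : FiniteDimensional ℂ V), p = charPoly b e V}

/-- The set of the linearized characteristic polynomials of all finite-dimensional
representations. -/
def LinCP (b : (IsKilling.rootSystem H).Base) : Set (MvPolynomial (Option b.support) ℂ) :=
  {p | ∃ (V : Type v) (_ : AddCommGroup V) (_ : Module ℂ V) (_ : LieRingModule L V)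
    (_ : LieModule ℂ L V) (_ : FiniteDimensional ℂ V), p = linCharPoly b V}

/-- `charPoly` of a finite-dimensional representation, as an element of `CP`. -/
def CP.of (b : (IsKilling.rootSystem H).Base) (e : H.root → L)
    (V : Type v) [AddCommGroup V] [Module ℂ V] [LieRingModule L V] [LieModule ℂ L V]
    [FiniteDimensional ℂ V] : CP.{u, v} b e :=
  ⟨charPoly b e V, V, _, _, _, ‹_›, ‹_›, rfl⟩

/-- `linCharPoly` of a finite-dimensional representation, as an element of `LinCP`. -/
def LinCP.of (b : (IsKilling.rootSystem H).Base)
    (V : Type v) [AddCommGroup V] [Module ℂ V] [LieRingModule L V] [LieModule ℂ L V]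
    [FiniteDimensional ℂ V] : LinCP.{u, v} b :=
  ⟨linCharPoly b V, V, _, _, _, ‹_›, ‹_›, rfl⟩

/-- The polynomial `∏_{λ, μ} (z₀ + ∑ i, (λ(h_{αᵢ}) + μ(h_{αᵢ})) zᵢ) ^ (d_λ d_μ)`, where `λ` and `μ`
run over the weights of the representations `V` and `W` with respect to the Cartan subalgebra `H`
and `d_λ`, `d_μ` are the dimensions of the corresponding simultaneous eigenspaces. -/
def weightProduct (b : (IsKilling.rootSystem H).Base)
    (V : Type v) [AddCommGroup V] [Module ℂ V] [LieRingModule L V] [LieModule ℂ L V]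
    [FiniteDimensional ℂ V]
    (W : Type v) [AddCommGroup W] [Module ℂ W] [LieRingModule L W] [LieModule ℂ L W]
    [FiniteDimensional ℂ W] : MvPolynomial (Option b.support) ℂ :=
  ∏ l : Weight ℂ H V, ∏ m : Weight ℂ H W,
    (X none + ∑ i : b.support, C (l (simpleCoroot b i) + m (simpleCoroot b i)) * X (some i)) ^
      (Module.finrank ℂ (weightSpace V l) * Module.finrank ℂ (weightSpace W m))

end LieCharPoly

end

/-! The Cartan subalgebra acts diagonalizably on every finite-dimensional representation, so a
linearized polynomial is the product of the linear forms given by the weights, with multiplicity.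
Seen as a monic polynomial in `z₀`, such a product has roots that recover the multiset of weights
(`linFormProd_injective`). Weights of a tensor product are sums of weights, so the linearized
polynomial of `V ⊗ W` depends only on those of `V` and `W` and equals the resolution product. The
monoid laws then come from the associativity, symmetry and unit isomorphisms of tensor products.

Diagonalizability is obtained without complete reducibility: the coroots span `H`, each lies in an
`sl₂` triple, and in such a triple `h` acts semisimply (`IsSl2Triple.lie_h_eq_smul_of_sq`).

Injectivity of `ρ` is an infinitesimal form of Chevalley's restriction argument. The polynomial
`f_φ` is annihilated by the derivations `D_β` coming from `ad E_β` (`linearDerivation_pencilDet`).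
Grade by the degree in the root variables. Up to terms that do not lower the degree, `D_β` is `c_β
∂/∂z_β`, where `c_β = -∑ β(h_{αᵢ}) zᵢ` is nonzero. If an invariant polynomial vanishes on `H`, its
lowest component `q` has positive degree and satisfies `∂q/∂z_β = 0` for all `β`, so `q = 0` by
Euler's identity (`MvPolynomial.eq_zero_of_derivation_eq_zero`). -/

namespace IsSl2Triple

/-! ### Semisimplicity of `h` in representations of an `sl₂` triple. -/

open LieModule

variable {K L M : Type*} [Field K] [CharZero K] [LieRing L] [LieAlgebra K L]
  [AddCommGroup M] [Module K M] [LieRingModule L M] [LieModule K L M] [FiniteDimensional K M]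
  {h e f : L}

/-- In a finite-dimensional representation of an `sl₂` triple, the raising operator is locally
nilpotent on eigenvectors of `h`. -/
lemma exists_pow_toEnd_e_eq_zero (t : IsSl2Triple h e f) {m : M} {μ : K}
    (hm : ⁅h, m⁆ = μ • m) : ∃ n : ℕ, ((toEnd K L M e) ^ n) m = 0 := by
  -- Otherwise the `eⁿ m` are eigenvectors of `h` for infinitely many eigenvalues `μ + 2n`.
  by_contra! contra
  let evals (n : ℕ) : K := μ + 2 * (n : K)
  have h_inj : Function.Injective evals := fun a b hab ↦ by
    simpa [evals, add_right_inj, mul_eq_mul_left_iff, Nat.cast_inj] using hab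
  have aux (ν : Set.range evals) : (toEnd K L M h).HasEigenvector ν
      (((toEnd K L M e) ^ ν.property.choose) m) := by
    set n := ν.property.choose
    refine ⟨?_, contra n⟩
    rw [Module.End.mem_eigenspace_iff, toEnd_apply_apply, ← ν.property.choose_spec]
    exact t.lie_h_pow_toEnd_e hm n
  have _i := ((toEnd K L M h).eigenvectors_linearIndependent (Set.range evals) _ aux).finite
  exact (Set.infinite_range_of_injective h_inj) (Set.toFinite _)

/-- In a finite-dimensional representation of an `sl₂` triple, the lowering operator is locally
nilpotent on eigenvectors of `h`. -/
lemma exists_pow_toEnd_f_eq_zero (t : IsSl2Triple h e f) {m : M} {μ : K}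
    (hm : ⁅h, m⁆ = μ • m) : ∃ n : ℕ, ((toEnd K L M f) ^ n) m = 0 :=
  t.symm.exists_pow_toEnd_e_eq_zero (μ := -μ) (by simp [hm])

/-- On a positive weight space of a finite-dimensional representation of an `sl₂` triple, `e f` is
injective. -/
lemma eq_zero_of_lie_e_lie_f_eq_zero (t : IsSl2Triple h e f) {u : M} {k : ℕ}
    (hu : ⁅h, u⁆ = ((k : K) + 1) • u) (hef : ⁅e, ⁅f, u⁆⁆ = 0) : u = 0 := by
  -- The coefficient never vanishes, so `e ^ (n + 1) u = 0` forces `e ^ n u = 0`; local nilpotence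
  -- of `e` then descends to `u = 0`.
  have key (j : ℕ) : ⁅f, ((toEnd K L M e) ^ (j + 1)) u⁆ =
      (-(((j : K) + 1) * ((k : K) + 1 + j))) • ((toEnd K L M e) ^ j) u := by
    have hfe (x : M) : ⁅f, ⁅e, x⁆⁆ = ⁅e, ⁅f, x⁆⁆ - ⁅h, x⁆ := by
      rw [← t.lie_e_f, lie_lie]; abel
    induction j with
    | zero =>
      simp only [zero_add, pow_one, toEnd_apply_apply, hfe, hef, hu, pow_zero, Module.End.one_apply]
      push_cast
      module
    | succ j ih =>
      rw [pow_succ', Module.End.mul_apply, toEnd_apply_apply, hfe, ih, lie_smul,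
        t.lie_h_pow_toEnd_e hu, lie_e_pow_toEnd_e, ← sub_smul]
      push_cast
      congr 1
      ring
  obtain ⟨n, hn⟩ := t.exists_pow_toEnd_e_eq_zero hu
  induction n with
  | zero => simpa using hn
  | succ n ih =>
    apply ih
    have := key n
    rw [hn, lie_zero, eq_comm, smul_eq_zero, neg_eq_zero, mul_eq_zero] at this
    refine this.resolve_left ?_
    norm_cast
    lia

/-- In a finite-dimensional representation of an `sl₂` triple, a generalized eigenvector of `h` of
rank at most two is an eigenvector. -/
lemma lie_h_eq_smul_of_sq (t : IsSl2Triple h e f) {v : M} {μ : K}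
    (hv : ⁅h, ⁅h, v⁆ - μ • v⁆ = μ • (⁅h, v⁆ - μ • v)) : ⁅h, v⁆ = μ • v := by
  by_contra hne
  -- Raise `v` until its defect of being an eigenvector is a primitive vector.
  obtain ⟨v, w, μ, hw, hwe, hvw, hw0⟩ : ∃ (v w : M) (μ : K), ⁅h, w⁆ = μ • w ∧ ⁅e, w⁆ = 0 ∧
      ⁅h, v⁆ = μ • v + w ∧ w ≠ 0 := by
    set w := ⁅h, v⁆ - μ • v with hw_def
    have hvw : ⁅h, v⁆ = μ • v + w := by rw [hw_def]; abel
    have hw0 : w ≠ 0 := sub_ne_zero.mpr hne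
    obtain ⟨n, hn₁, hn₂⟩ := Nat.exists_not_and_succ_of_not_zero_of_exists
      (p := fun n ↦ ((toEnd K L M e) ^ n) w = 0) (by simpa) (t.exists_pow_toEnd_e_eq_zero hv)
    have hcomm (j : ℕ) : ⁅h, ((toEnd K L M e) ^ j) v⁆ =
        (μ + 2 * j) • ((toEnd K L M e) ^ j) v + ((toEnd K L M e) ^ j) w := by
      induction j with
      | zero => simp [hvw]
      | succ j ih =>
        rw [pow_succ', Module.End.mul_apply, Module.End.mul_apply, toEnd_apply_apply,
          toEnd_apply_apply, leibniz_lie h, t.lie_h_e_smul K, smul_lie, ih, lie_add, lie_smul]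
        push_cast
        module
    exact ⟨_, _, _, t.lie_h_pow_toEnd_e hv n, by rwa [lie_e_pow_toEnd_e], hcomm n, hn₁⟩
  clear hne hv
  have hP : HasPrimitiveVectorWith t w μ := ⟨hw0, hw, hwe⟩
  obtain ⟨k, rfl⟩ := hP.exists_nat
  -- Correct `v` so that it is annihilated by `e`.
  obtain ⟨v, hev, hvw⟩ : ∃ v : M, ⁅e, v⁆ = 0 ∧ ⁅h, v⁆ = (k : K) • v + w := by
    let U := (toEnd K L M h).eigenspace ((k : K) + 2)
    have hU (x : M) : x ∈ U ↔ ⁅h, x⁆ = ((k : K) + 2) • x := by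
      simp [U]
    have hhf (x : M) (hx : x ∈ U) : ⁅h, ⁅f, x⁆⁆ = (k : K) • ⁅f, x⁆ := by
      rw [leibniz_lie, t.lie_lie_smul_f K, (hU x).1 hx, neg_lie, smul_lie, lie_smul]
      module
    have hhe (x : M) (z : M) (hx : ⁅h, x⁆ = (k : K) • x + z) (hz : ⁅e, z⁆ = 0) :
        ⁅e, x⁆ ∈ U := by
      rw [hU, leibniz_lie, t.lie_h_e_smul K, hx, lie_add, hz, smul_lie, lie_smul]
      module
    let T : U →ₗ[K] U := (toEnd K L M e ∘ₗ toEnd K L M f).restrict (fun x hx ↦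
      hhe _ 0 (by simpa using hhf x hx) (by simp))
    have hT : Function.Injective T := by
      rw [← LinearMap.ker_eq_bot, LinearMap.ker_eq_bot']
      intro x hx
      ext
      refine t.eq_zero_of_lie_e_lie_f_eq_zero (K := K) (k := k + 1) ?_ (congr_arg Subtype.val hx)
      rw [(hU _).1 x.2]
      push_cast
      module
    -- Injectivity of `e f` on the finite-dimensional eigenspace `U` gives surjectivity, so `⁅e, v⁆`
    -- can be cancelled by subtracting some `⁅f, u⁆`, an eigenvector for the same eigenvalue `k`.
    obtain ⟨u, hu⟩ := LinearMap.surjective_of_injective hT ⟨⁅e, v⁆, hhe v w hvw hwe⟩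
    have hu' : ⁅e, ⁅f, (u : M)⁆⁆ = ⁅e, v⁆ := congr_arg Subtype.val hu
    refine ⟨v - ⁅f, (u : M)⁆, by simp [hu'], ?_⟩
    rw [lie_sub, hvw, hhf _ u.2]
    module
  -- The vectors `f ^ j v` with `k < j` never vanish.
  have hh (j : ℕ) : ⁅h, ((toEnd K L M f) ^ j) v⁆ =
      ((k : K) - 2 * j) • ((toEnd K L M f) ^ j) v + ((toEnd K L M f) ^ j) w := by
    induction j with
    | zero => simp [hvw]
    | succ j ih =>
      rw [pow_succ', Module.End.mul_apply, Module.End.mul_apply, toEnd_apply_apply,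
        toEnd_apply_apply, leibniz_lie h, t.lie_lie_smul_f K, neg_lie, smul_lie, ih, lie_add,
        lie_smul]
      push_cast
      module
  have hf (j : ℕ) : ⁅e, ((toEnd K L M f) ^ (j + 1)) v⁆ =
      (((j : K) + 1) * (k - j)) • ((toEnd K L M f) ^ j) v +
        ((j : K) + 1) • ((toEnd K L M f) ^ j) w := by
    induction j with
    | zero => simp [leibniz_lie e, t.lie_e_f, hev, hvw]
    | succ j ih =>
      rw [pow_succ', Module.End.mul_apply, toEnd_apply_apply, leibniz_lie e, t.lie_e_f, hh, ih,
        lie_add, lie_smul, lie_smul, ← toEnd_apply_apply K L M f, ← toEnd_apply_apply K L M f,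
        ← Module.End.mul_apply, ← Module.End.mul_apply, ← pow_succ']
      push_cast
      module
  have hwk (j : ℕ) : ((toEnd K L M f) ^ (k + 1 + j)) w = 0 := by
    rw [add_comm, pow_add, Module.End.mul_apply, hP.pow_toEnd_f_eq_zero_of_eq_nat rfl, map_zero]
  -- In `hf` the coefficient `k - j` vanishes only at `j = k`, where the other term `(k + 1) f ^ k
  -- w` is nonzero; beyond that the `w` term is gone.
  have hne (j : ℕ) : ((toEnd K L M f) ^ (k + 1 + j)) v ≠ 0 := by
    induction j with
    | zero =>
      intro h0
      have := hf k
      rw [add_zero] at h0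
      rw [h0, lie_zero, sub_self, mul_zero, zero_smul, zero_add, eq_comm, smul_eq_zero] at this
      exact this.elim (by norm_cast) (hP.pow_toEnd_f_ne_zero_of_eq_nat rfl le_rfl)
    | succ j ih =>
      intro h0
      have := hf (k + 1 + j)
      rw [add_assoc, h0, lie_zero, hwk, smul_zero, add_zero, eq_comm, smul_eq_zero,
        mul_eq_zero] at this
      push_cast at this
      rcases this with (h1 | h1) | h1
      · norm_cast at h1
      · rw [sub_eq_zero] at h1
        norm_cast at h1
        lia
      · exact ih h1
  -- Since `f ^ (k + 1) w = 0`, the vector `f ^ (k + 1) v` is a true eigenvector of `h`, so local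
  -- nilpotence applies to it.
  obtain ⟨n, hn⟩ := t.exists_pow_toEnd_f_eq_zero (m := ((toEnd K L M f) ^ (k + 1)) v)
    (μ := (k : K) - 2 * (k + 1 : ℕ)) (by simpa using (hh (k + 1)).trans (by simpa using hwk 0))
  rw [← Module.End.mul_apply, ← pow_add, add_comm] at hn
  exact hne n hn

/-- In a finite-dimensional representation of an `sl₂` triple, every generalized eigenvector of `h`
is an eigenvector. -/
lemma lie_h_eq_smul_of_mem_maxGenEigenspace (t : IsSl2Triple h e f) {v : M} {μ : K}
    (hv : v ∈ (toEnd K L M h).maxGenEigenspace μ) : ⁅h, v⁆ = μ • v := by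
  obtain ⟨n, hn⟩ := Module.End.mem_maxGenEigenspace _ _ _ |>.1 hv
  clear hv
  induction n generalizing v with
  | zero => simp_all
  | succ n ih =>
    rw [pow_succ, Module.End.mul_apply] at hn
    -- By `ih`, `⁅h, v⁆ - μ • v` is an eigenvector, so `v` has rank at most two.
    exact t.lie_h_eq_smul_of_sq (by simpa using ih hn)

end IsSl2Triple

/-! ### Determinants of pencils and products of linear forms. -/

noncomputable section

namespace LieCharPoly

open MvPolynomial LieAlgebra LieModule

section Pencil

variable {L : Type u} [LieRing L] [LieAlgebra ℂ L] {σ : Type*} [Fintype σ]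

/-- The matrix `z₀ I + ∑ i, zᵢ A i` over the polynomial ring. -/
def pencilMatrix {ι : Type*} [DecidableEq ι] (A : σ → Matrix ι ι ℂ) :
    Matrix ι ι (MvPolynomial (Option σ) ℂ) :=
  (X none : MvPolynomial (Option σ) ℂ) • (1 : Matrix ι ι (MvPolynomial (Option σ) ℂ)) +
    ∑ i, (X (some i) : MvPolynomial (Option σ) ℂ) • (A i).map C

lemma pencilDet_eq_det_pencilMatrix (x : σ → L) {V : Type v} [AddCommGroup V] [Module ℂ V]
    [LieRingModule L V] [LieModule ℂ L V] {ι : Type*} [Fintype ι] [DecidableEq ι]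
    (B : Module.Basis ι ℂ V) :
    pencilDet x V =
      (pencilMatrix fun i ↦ LinearMap.toMatrix B B (toEnd ℂ L V (x i))).det := by
  rw [pencilDet, ← LinearMap.det_toMatrix
    (Algebra.TensorProduct.basis (MvPolynomial (Option σ) ℂ) B)]
  congr 1
  simp only [pencilMatrix, map_add, map_smul, map_sum, LinearMap.toMatrix_id,
    LinearMap.toMatrix_baseChange, algebraMap_eq]

lemma pencilDet_congr (x : σ → L) {V : Type*} [AddCommGroup V] [Module ℂ V]
    [LieRingModule L V] [LieModule ℂ L V] [FiniteDimensional ℂ V]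
    {W : Type*} [AddCommGroup W] [Module ℂ W] [LieRingModule L W] [LieModule ℂ L W]
    (φ : V ≃ₗ[ℂ] W) (hφ : ∀ (y : L) (m : V), φ ⁅y, m⁆ = ⁅y, φ m⁆) :
    pencilDet x V = pencilDet x W := by
  let B := Module.finBasis ℂ V
  rw [pencilDet_eq_det_pencilMatrix x B, pencilDet_eq_det_pencilMatrix x (B.map φ)]
  congr 2
  ext i j k
  simp [LinearMap.toMatrix_apply, ← hφ]

/-- The product of the linear forms `z₀ + ∑ i, a i zᵢ`, for `a` in a multiset. -/
def linFormProd (s : Multiset (σ → ℂ)) : MvPolynomial (Option σ) ℂ :=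
  (s.map fun a ↦ X none + ∑ i, C (a i) * X (some i)).prod

/-- The characteristic polynomial of a family with a basis of simultaneous eigenvectors. -/
lemma pencilDet_eq_linFormProd (x : σ → L) {V : Type v} [AddCommGroup V] [Module ℂ V]
    [LieRingModule L V] [LieModule ℂ L V] {ι : Type*} [Fintype ι]
    (B : Module.Basis ι ℂ V) (w : ι → σ → ℂ) (hw : ∀ k i, ⁅x i, B k⁆ = w k i • B k) :
    pencilDet x V = linFormProd (Finset.univ.val.map w) := by
  classical
  have hA : (pencilMatrix fun i ↦ LinearMap.toMatrix B B (toEnd ℂ L V (x i))) =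
      Matrix.diagonal fun k ↦
        (X none + ∑ i, C (w k i) * X (some i) : MvPolynomial (Option σ) ℂ) := by
    ext1 k l
    simp only [pencilMatrix, Matrix.add_apply, Matrix.smul_apply, Matrix.sum_apply,
      Matrix.map_apply, LinearMap.toMatrix_apply, toEnd_apply_apply, hw, map_smul, smul_eq_mul,
      Finsupp.smul_apply, Module.Basis.repr_self, Matrix.one_apply, Matrix.diagonal_apply]
    by_cases h : k = l
    · subst h; simp [mul_comm]
    · simp [h]
  rw [pencilDet_eq_det_pencilMatrix x B, hA, Matrix.det_diagonal, linFormProd, Multiset.map_map]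
  rfl

/-- As a polynomial in `z₀` over the domain `ℂ[zᵢ]`, the product is monic and split with roots `-∑
i, a i zᵢ`, and each root determines `a`. -/
lemma linFormProd_injective : Function.Injective (linFormProd (σ := σ)) := by
  classical
  let lin (a : σ → ℂ) : MvPolynomial σ ℂ := -∑ i, C (a i) * X i
  have hlin : Function.Injective lin := by
    intro a b hab
    ext j
    have := congr_arg (coeff (Finsupp.single j 1)) hab
    simpa [lin, coeff_sum, coeff_C_mul, coeff_X, Finsupp.single_left_inj] using this
  have key (s : Multiset (σ → ℂ)) : (optionEquivLeft ℂ σ (linFormProd s)).roots = s.map lin := by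
    have : optionEquivLeft ℂ σ (linFormProd s) =
        ((s.map lin).map fun a ↦ Polynomial.X - Polynomial.C a).prod := by
      rw [linFormProd, map_multiset_prod, Multiset.map_map, Multiset.map_map]
      congr 1
      refine Multiset.map_congr rfl fun a _ ↦ ?_
      simp [lin, optionEquivLeft_X_none, optionEquivLeft_X_some, optionEquivLeft_C]
    rw [this, Polynomial.roots_multiset_prod_X_sub_C]
  intro s t hst
  refine Multiset.map_injective hlin ?_
  rw [← key, ← key, hst]

end Pencil

end LieCharPoly

end

/-! ### Weight bases and the resolution product of linearized polynomials. -/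

noncomputable section

namespace LieCharPoly

open MvPolynomial LieAlgebra LieModule

section WeightBasis

lemma prod_map_univ_sigma_fin {ι M : Type*} [Fintype ι] [CommMonoid M] (d : ι → ℕ)
    (g : ι → M) :
    ((Finset.univ : Finset (Σ i, Fin (d i))).val.map fun k ↦ g k.1).prod = ∏ i, g i ^ d i := by
  rw [← Finset.prod_eq_multiset_prod, Fintype.prod_sigma]
  simp

variable {L : Type u} [LieRing L] [LieAlgebra ℂ L] [FiniteDimensional ℂ L] [IsKilling ℂ L]
  {H : LieSubalgebra ℂ L} [H.IsCartanSubalgebra]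
  {V : Type v} [AddCommGroup V] [Module ℂ V] [LieRingModule L V] [LieModule ℂ L V]
  [FiniteDimensional ℂ V]

/-- A Cartan subalgebra of a semisimple Lie algebra acts diagonalizably on every
finite-dimensional representation. -/
lemma lie_eq_smul_of_mem_genWeightSpace (χ : Weight ℂ H V) {m : V}
    (hm : m ∈ genWeightSpace V χ) (x : H) : ⁅x, m⁆ = χ x • m := by
  -- The claim is linear in `x`, so it may be checked on the coroots, which span `H`.
  suffices (⊤ : Submodule ℂ H) ≤ LinearMap.ker
      ((toEnd ℂ H V : H →ₗ[ℂ] Module.End ℂ V).flip m - χ.toLinear.smulRight m) by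
    simpa [sub_eq_zero] using this (Submodule.mem_top (x := x))
  rw [← RootPairing.IsRootSystem.span_coroot_eq_top (P := IsKilling.rootSystem H),
    Submodule.span_le]
  rintro _ ⟨α, rfl⟩
  have hα : (α : Weight ℂ H L).IsNonZero := H.isNonZero_coe_root α
  obtain ⟨h, e, f, t, he, hf⟩ := IsKilling.exists_isSl2Triple_of_weight_isNonZero hα
  have hh := t.h_eq_coroot hα he hf
  have hm' := (mem_genWeightSpace V _ m).1 hm (IsKilling.coroot α.1)
  have := t.lie_h_eq_smul_of_mem_maxGenEigenspace (K := ℂ) (v := m)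
    (μ := χ (IsKilling.coroot α.1)) (by
      rw [hh, Module.End.mem_maxGenEigenspace]
      exact hm')
  rw [hh] at this
  simpa [sub_eq_zero] using this

lemma weightSpace_eq_genWeightSpace (χ : Weight ℂ H V) :
    weightSpace V χ = genWeightSpace V χ :=
  le_antisymm (weightSpace_le_genWeightSpace V χ) fun _ hm ↦
    (mem_weightSpace _ _).2 (lie_eq_smul_of_mem_genWeightSpace χ hm)

variable (H V) in
/-- A finite-dimensional representation of a semisimple Lie algebra has a basis of weight
vectors. -/
lemma exists_weightBasis :
    ∃ B : Module.Basis (Σ χ : Weight ℂ H V, Fin (Module.finrank ℂ (weightSpace V χ))) ℂ V,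
      ∀ k (x : H), ⁅(x : L), B k⁆ = k.1 x • B k := by
  classical
  have hint : DirectSum.IsInternal
      fun χ : Weight ℂ H V ↦ (weightSpace V χ).toSubmodule := by
    simp only [weightSpace_eq_genWeightSpace]
    refine DirectSum.isInternal_submodule_of_iSupIndep_of_iSup_eq_top ?_ ?_
    · exact LieSubmodule.iSupIndep_toSubmodule.mpr (iSupIndep_genWeightSpace' ℂ H V)
    · rw [← LieSubmodule.iSup_toSubmodule, iSup_genWeightSpace_eq_top' ℂ H V,
        LieSubmodule.top_toSubmodule]
  refine ⟨hint.collectedBasis fun χ ↦ Module.finBasis ℂ (weightSpace V χ), fun k x ↦ ?_⟩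
  exact (mem_weightSpace _ _).1 (hint.collectedBasis_mem _ k) x

end WeightBasis

section TrivialRep

/-- The one-dimensional trivial representation, in an arbitrary universe. -/
def TrivialRep : Type v := ULift.{v} ℂ

namespace TrivialRep

instance : AddCommGroup TrivialRep := inferInstanceAs (AddCommGroup (ULift ℂ))
instance : Module ℂ TrivialRep := inferInstanceAs (Module ℂ (ULift ℂ))

/-- The identification of the trivial representation with the ground field. -/
def equiv : TrivialRep ≃ₗ[ℂ] ℂ := ULift.moduleEquiv

instance : FiniteDimensional ℂ TrivialRep := Module.Finite.equiv equiv.symm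

variable {L : Type u} [LieRing L] [LieAlgebra ℂ L]

instance : LieRingModule L TrivialRep where
  bracket _ _ := 0
  add_lie _ _ _ := (add_zero 0).symm
  lie_add _ _ _ := (add_zero 0).symm
  leibniz_lie _ _ _ := (add_zero 0).symm

omit [LieAlgebra ℂ L] in
lemma lie_eq_zero (x : L) (m : TrivialRep) : ⁅x, m⁆ = 0 := rfl

instance : LieModule ℂ L TrivialRep where
  smul_lie _ _ _ := (smul_zero _).symm
  lie_smul _ _ _ := (smul_zero _).symm

end TrivialRep

lemma pencilDet_trivialRep {L : Type u} [LieRing L] [LieAlgebra ℂ L] {σ : Type*} [Fintype σ]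
    (x : σ → L) : pencilDet x TrivialRep.{v} = X none := by
  rw [pencilDet_eq_linFormProd x ((Module.Basis.singleton Unit ℂ).map TrivialRep.equiv.symm) 0
    (by simp [TrivialRep.lie_eq_zero])]
  simp [linFormProd]

end TrivialRep

section LinCP

variable {L : Type u} [LieRing L] [LieAlgebra ℂ L] [FiniteDimensional ℂ L] [IsSimple ℂ L]
  {H : LieSubalgebra ℂ L} [H.IsCartanSubalgebra] (b : (IsKilling.rootSystem H).Base)
  (V : Type v) [AddCommGroup V] [Module ℂ V] [LieRingModule L V] [LieModule ℂ L V]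
  [FiniteDimensional ℂ V]
  (W : Type v) [AddCommGroup W] [Module ℂ W] [LieRingModule L W] [LieModule ℂ L W]
  [FiniteDimensional ℂ W]

/-- The multiset of the weights of a representation, evaluated at the simple coroots. -/
def weightMultiset : Multiset (b.support → ℂ) :=
  (Finset.univ : Finset (Σ χ : Weight ℂ H V, Fin (Module.finrank ℂ (weightSpace V χ)))).val.map
    fun k i ↦ k.1 (simpleCoroot b i)

lemma linCharPoly_eq : linCharPoly b V = linFormProd (weightMultiset b V) := by
  obtain ⟨B, hB⟩ := exists_weightBasis H V
  exact pencilDet_eq_linFormProd _ B _ fun k i ↦ hB k (simpleCoroot b i)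

/-- Tensors of weight vectors are weight vectors for the sum of the weights. The multiset form shows
that only the two weight multisets matter. -/
lemma linCharPoly_tensorProduct_eq :
    linCharPoly b (V ⊗[ℂ] W) = linFormProd
      ((weightMultiset b V ×ˢ weightMultiset b W).map fun p ↦ p.1 + p.2) := by
  obtain ⟨B, hB⟩ := exists_weightBasis H V
  obtain ⟨B', hB'⟩ := exists_weightBasis H W
  rw [linCharPoly, pencilDet_eq_linFormProd _ (B.tensorProduct B')
    (fun k i ↦ k.1.1 (simpleCoroot b i) + k.2.1 (simpleCoroot b i))]
  · rw [weightMultiset, weightMultiset, ← Finset.univ_product_univ, Finset.product_val]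
    simp only [SProd.sprod, Multiset.product, Multiset.map_bind, Multiset.map_map,
      Multiset.bind_map]
    rfl
  · rintro ⟨k, l⟩ i
    rw [Module.Basis.tensorProduct_apply, TensorProduct.LieModule.lie_tmul_right, simpleCoroot,
      hB, hB', add_smul, TensorProduct.smul_tmul', TensorProduct.tmul_smul]

lemma linCharPoly_tensorProduct_eq_weightProduct :
    linCharPoly b (V ⊗[ℂ] W) = weightProduct b V W := by
  rw [linCharPoly_tensorProduct_eq, linFormProd, weightMultiset, weightMultiset, weightProduct]
  simp only [SProd.sprod, Multiset.product, Multiset.map_bind, Multiset.map_map,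
    Multiset.bind_map, Multiset.prod_bind, Function.comp_def, Pi.add_apply]
  let g (χ : Weight ℂ H V) (μ : Weight ℂ H W) : MvPolynomial (Option b.support) ℂ :=
    X none + ∑ i, C (χ (simpleCoroot b i) + μ (simpleCoroot b i)) * X (some i)
  refine (congr_arg Multiset.prod (Multiset.map_congr rfl fun k _ ↦
    prod_map_univ_sigma_fin _ (g k.1))).trans ?_
  refine (prod_map_univ_sigma_fin _
    fun χ ↦ ∏ μ, g χ μ ^ Module.finrank ℂ (weightSpace W μ)).trans ?_
  refine Finset.prod_congr rfl fun χ _ ↦ ?_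
  rw [← Finset.prod_pow]
  exact Finset.prod_congr rfl fun μ _ ↦ by rw [← pow_mul, mul_comm]

variable {b V W} in
-- Well-definedness of the resolution product: the linearized polynomials determine the weight
-- multisets.
lemma linCharPoly_tensorProduct_congr
    {V' : Type v} [AddCommGroup V'] [Module ℂ V'] [LieRingModule L V'] [LieModule ℂ L V']
    [FiniteDimensional ℂ V']
    {W' : Type v} [AddCommGroup W'] [Module ℂ W'] [LieRingModule L W'] [LieModule ℂ L W']
    [FiniteDimensional ℂ W']
    (hV : linCharPoly b V = linCharPoly b V') (hW : linCharPoly b W = linCharPoly b W') :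
    linCharPoly b (V ⊗[ℂ] W) = linCharPoly b (V' ⊗[ℂ] W') := by
  rw [linCharPoly_eq, linCharPoly_eq] at hV hW
  rw [linCharPoly_tensorProduct_eq, linCharPoly_tensorProduct_eq, linFormProd_injective hV,
    linFormProd_injective hW]

end LinCP

section Monoid

variable {L : Type u} [LieRing L] [LieAlgebra ℂ L]
  {V W U : Type*} [AddCommGroup V] [Module ℂ V] [LieRingModule L V] [LieModule ℂ L V]
  [AddCommGroup W] [Module ℂ W] [LieRingModule L W] [LieModule ℂ L W]
  [AddCommGroup U] [Module ℂ U] [LieRingModule L U] [LieModule ℂ L U]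

lemma tensorProduct_comm_lie (x : L) (m : V ⊗[ℂ] W) :
    TensorProduct.comm ℂ V W ⁅x, m⁆ = ⁅x, TensorProduct.comm ℂ V W m⁆ := by
  induction m using TensorProduct.induction_on with
  | zero => simp
  | tmul v w => simp [add_comm]
  | add a c ha hc => simp only [lie_add, map_add, ha, hc]

lemma tensorProduct_assoc_lie (x : L) (m : (V ⊗[ℂ] W) ⊗[ℂ] U) :
    TensorProduct.assoc ℂ V W U ⁅x, m⁆ = ⁅x, TensorProduct.assoc ℂ V W U m⁆ := by
  induction m using TensorProduct.induction_on with
  | zero => simp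
  | tmul m u =>
    induction m using TensorProduct.induction_on with
    | zero => simp
    | tmul v w => simp [TensorProduct.add_tmul, TensorProduct.tmul_add, add_assoc]
    | add a c ha hc => simp only [TensorProduct.add_tmul, lie_add, map_add, ha, hc]
  | add a c ha hc => simp only [lie_add, map_add, ha, hc]

variable (V) in
/-- Tensoring with the trivial representation does nothing. -/
def trivialRepTensorEquiv : TrivialRep.{v} ⊗[ℂ] V ≃ₗ[ℂ] V :=
  TensorProduct.congr TrivialRep.equiv (LinearEquiv.refl ℂ V) ≪≫ₗ TensorProduct.lid ℂ V

lemma trivialRepTensorEquiv_lie (x : L) (m : TrivialRep.{v} ⊗[ℂ] V) :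
    trivialRepTensorEquiv V ⁅x, m⁆ = ⁅x, trivialRepTensorEquiv V m⁆ := by
  induction m using TensorProduct.induction_on with
  | zero => simp
  | tmul v w => simp [trivialRepTensorEquiv, TrivialRep.lie_eq_zero]
  | add a c ha hc => simp only [lie_add, map_add, ha, hc]

end Monoid

/-! ### The monoid of linearized polynomials. -/

section LinCPMonoid

variable {L : Type u} [LieRing L] [LieAlgebra ℂ L] [FiniteDimensional ℂ L] [IsSimple ℂ L]
  {H : LieSubalgebra ℂ L} [H.IsCartanSubalgebra] {b : (IsKilling.rootSystem H).Base}

variable (L) in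
/-- A bundled finite-dimensional representation. -/
structure FinRep where
  /-- The underlying space. -/
  carrier : Type v
  [addCommGroup : AddCommGroup carrier]
  [module : Module ℂ carrier]
  [lieRingModule : LieRingModule L carrier]
  [lieModule : LieModule ℂ L carrier]
  [finiteDimensional : FiniteDimensional ℂ carrier]

attribute [instance] FinRep.addCommGroup FinRep.module FinRep.lieRingModule FinRep.lieModule
  FinRep.finiteDimensional

lemma LinCP.exists_eq_of (p : LinCP.{u, v} b) :
    ∃ V : FinRep.{u, v} L, p = LinCP.of b V.carrier := by
  obtain ⟨p, V, _, _, _, _, _, rfl⟩ := p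
  exact ⟨⟨V⟩, rfl⟩

/-- A representation with a given linearized polynomial. -/
def LinCP.rep (p : LinCP.{u, v} b) : FinRep.{u, v} L := (LinCP.exists_eq_of p).choose

lemma LinCP.of_rep (p : LinCP.{u, v} b) : LinCP.of b (LinCP.rep p).carrier = p :=
  (LinCP.exists_eq_of p).choose_spec.symm

/-- The resolution product of linearized polynomials. -/
@[reducible]
def LinCP.mul : Mul (LinCP.{u, v} b) where
  mul p q := LinCP.of b ((LinCP.rep p).carrier ⊗[ℂ] (LinCP.rep q).carrier)

attribute [local instance] LinCP.mul

/-- `LinCP.mul` uses chosen representations; this is independence of the choice. -/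
lemma LinCP.of_mul_of (V : Type v) [AddCommGroup V] [Module ℂ V] [LieRingModule L V]
    [LieModule ℂ L V] [FiniteDimensional ℂ V]
    (W : Type v) [AddCommGroup W] [Module ℂ W] [LieRingModule L W] [LieModule ℂ L W]
    [FiniteDimensional ℂ W] :
    LinCP.of b V * LinCP.of b W = LinCP.of b (V ⊗[ℂ] W) :=
  Subtype.ext <| linCharPoly_tensorProduct_congr
    (congr_arg Subtype.val (LinCP.of_rep (LinCP.of b V)))
    (congr_arg Subtype.val (LinCP.of_rep (LinCP.of b W)))

lemma LinCP.of_congr {V : Type v} [AddCommGroup V] [Module ℂ V] [LieRingModule L V]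
    [LieModule ℂ L V] [FiniteDimensional ℂ V]
    {W : Type v} [AddCommGroup W] [Module ℂ W] [LieRingModule L W] [LieModule ℂ L W]
    [FiniteDimensional ℂ W] (φ : V ≃ₗ[ℂ] W) (hφ : ∀ (y : L) (m : V), φ ⁅y, m⁆ = ⁅y, φ m⁆) :
    LinCP.of b V = LinCP.of b W :=
  Subtype.ext <| pencilDet_congr _ φ hφ

/-- The monoid of linearized polynomials under the resolution product. -/
@[reducible]
def LinCP.commMonoid : CommMonoid (LinCP.{u, v} b) where
  one := LinCP.of b TrivialRep.{v}
  mul_assoc p q r := by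
    obtain ⟨V, rfl⟩ := LinCP.exists_eq_of p
    obtain ⟨W, rfl⟩ := LinCP.exists_eq_of q
    obtain ⟨U, rfl⟩ := LinCP.exists_eq_of r
    simp only [LinCP.of_mul_of]
    exact LinCP.of_congr _ tensorProduct_assoc_lie
  mul_comm p q := by
    obtain ⟨V, rfl⟩ := LinCP.exists_eq_of p
    obtain ⟨W, rfl⟩ := LinCP.exists_eq_of q
    simp only [LinCP.of_mul_of]
    exact LinCP.of_congr _ tensorProduct_comm_lie
  one_mul p := by
    obtain ⟨V, rfl⟩ := LinCP.exists_eq_of p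
    refine (LinCP.of_mul_of _ _).trans (LinCP.of_congr _ trivialRepTensorEquiv_lie)
  mul_one p := by
    obtain ⟨V, rfl⟩ := LinCP.exists_eq_of p
    refine (LinCP.of_mul_of _ _).trans (LinCP.of_congr
      (TensorProduct.comm ℂ _ _ ≪≫ₗ trivialRepTensorEquiv V.carrier) fun y m ↦ ?_)
    simp only [LinearEquiv.trans_apply, tensorProduct_comm_lie, trivialRepTensorEquiv_lie]

attribute [local instance] LinCP.commMonoid

lemma LinCP.coe_one : ((1 : LinCP.{u, v} b) : MvPolynomial (Option b.support) ℂ) = X none :=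
  pencilDet_trivialRep _

end LinCPMonoid

end LieCharPoly

end

/-! ### The weight filtration of a polynomial ring, and derivations. -/

noncomputable section

namespace MvPolynomial

section WeightFiltration

variable {τ R : Type*} [CommRing R] (w : τ → ℕ)

/-- The ideal of the polynomials all of whose monomials have weight at least `k`. -/
def weightIdeal (k : ℕ) : Ideal (MvPolynomial τ R) where
  carrier := {p | ∀ m, coeff m p ≠ 0 → k ≤ Finsupp.weight w m}
  zero_mem' := by simp
  add_mem' {p q} hp hq m hm := by
    by_cases h : coeff m p = 0
    · exact hq m fun h' ↦ hm (by rw [coeff_add, h, h', add_zero])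
    · exact hp m h
  smul_mem' c p hp m hm := by
    classical
    rw [smul_eq_mul, coeff_mul] at hm
    obtain ⟨x, hx, hne⟩ := Finset.exists_ne_zero_of_sum_ne_zero hm
    rw [← Finset.HasAntidiagonal.mem_antidiagonal.1 hx, map_add]
    exact (hp _ (right_ne_zero_of_mul hne)).trans (Nat.le_add_left _ _)

variable {w}

lemma weightIdeal_anti {k l : ℕ} (h : k ≤ l) :
    weightIdeal (R := R) w l ≤ weightIdeal w k :=
  fun _ hp m hm ↦ h.trans (hp m hm)

lemma mul_mem_weightIdeal {k l : ℕ} {p q : MvPolynomial τ R} (hp : p ∈ weightIdeal w k)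
    (hq : q ∈ weightIdeal w l) : p * q ∈ weightIdeal w (k + l) := by
  classical
  intro m hm
  rw [coeff_mul] at hm
  obtain ⟨x, hx, hne⟩ := Finset.exists_ne_zero_of_sum_ne_zero hm
  rw [← Finset.HasAntidiagonal.mem_antidiagonal.1 hx, map_add]
  exact add_le_add (hp _ (left_ne_zero_of_mul hne)) (hq _ (right_ne_zero_of_mul hne))

lemma monomial_mem_weightIdeal (m : τ →₀ ℕ) (r : R) :
    monomial m r ∈ weightIdeal w (Finsupp.weight w m) := by
  classical
  intro m' hm'
  rw [coeff_monomial] at hm'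
  rw [of_not_not fun h ↦ hm' (if_neg h)]

lemma X_mem_weightIdeal (j : τ) : (X j : MvPolynomial τ R) ∈ weightIdeal w (w j) := by
  simpa [Finsupp.weight_single, X] using
    monomial_mem_weightIdeal (w := w) (Finsupp.single j 1) (1 : R)

lemma pderiv_mem_weightIdeal {k : ℕ} {p : MvPolynomial τ R} {i : τ} (hi : w i ≤ 1)
    (hp : p ∈ weightIdeal w (k + 1)) : pderiv i p ∈ weightIdeal w k := by
  intro m hm
  rw [coeff_pderiv] at hm
  have := hp _ (left_ne_zero_of_mul hm)
  rw [map_add, Finsupp.weight_single, one_smul] at this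
  lia

/-- By the Leibniz rule, a derivation that does not lower the weight of any variable does not lower
the weight of any monomial. -/
lemma derivation_mem_weightIdeal (D : Derivation R (MvPolynomial τ R) (MvPolynomial τ R))
    (hD : ∀ j, D (X j) ∈ weightIdeal w (w j)) {k : ℕ} {p : MvPolynomial τ R}
    (hp : p ∈ weightIdeal w k) : D p ∈ weightIdeal w k := by
  have hadd (a c : τ →₀ ℕ) (ha : D (monomial a 1) ∈ weightIdeal w (Finsupp.weight w a))
      (hc : D (monomial c 1) ∈ weightIdeal w (Finsupp.weight w c)) :
      D (monomial (a + c) 1) ∈ weightIdeal w (Finsupp.weight w (a + c)) := by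
    rw [← one_mul (1 : R), ← monomial_mul, D.leibniz, map_add, smul_eq_mul, smul_eq_mul]
    refine add_mem (mul_mem_weightIdeal (monomial_mem_weightIdeal a 1) hc) ?_
    rw [add_comm]
    exact mul_mem_weightIdeal (monomial_mem_weightIdeal c 1) ha
  have hmon (m : τ →₀ ℕ) : D (monomial m 1) ∈ weightIdeal w (Finsupp.weight w m) := by
    induction m using Finsupp.induction_linear with
    | zero => simp
    | add a c ha hc => exact hadd a c ha hc
    | single i n =>
      induction n with
      | zero => simp
      | succ n ih =>
        rw [Finsupp.single_add]
        refine hadd _ _ ih ?_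
        simpa [Finsupp.weight_single, X] using hD i
  rw [p.as_sum, map_sum]
  refine sum_mem fun m hm ↦ ?_
  rw [← mul_one (coeff m p), ← smul_eq_mul, ← smul_monomial, D.map_smul, smul_eq_C_mul]
  exact Ideal.mul_mem_left _ _ (weightIdeal_anti (hp m (mem_support_iff.1 hm)) (hmon m))

lemma eq_zero_of_mem_weightIdeal {k n : ℕ} (hn : n < k) {p : MvPolynomial τ R}
    (hp : IsWeightedHomogeneous w p n) (hp' : p ∈ weightIdeal w k) : p = 0 := by
  ext m
  by_contra h
  have := hp' m h
  rw [hp h] at this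
  lia

/-- If derivations `D β`, for `β` of weight one, agree up to terms of positive weight with
nonzero multiples of the partial derivatives, then a polynomial without terms of weight zero that
they all annihilate is zero. -/
lemma eq_zero_of_derivation_eq_zero [Fintype τ] [IsDomain R] [CharZero R] (hw : ∀ j, w j ≤ 1)
    (D : τ → Derivation R (MvPolynomial τ R) (MvPolynomial τ R)) (c : τ → MvPolynomial τ R)
    (hc : ∀ β, w β = 1 → IsWeightedHomogeneous w (c β) 0) (hc0 : ∀ β, w β = 1 → c β ≠ 0)
    (hD : ∀ β, w β = 1 → ∀ j, D β (X j) - c β * pderiv β (X j) ∈ weightIdeal w 1)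
    {p : MvPolynomial τ R} (hp : p ∈ weightIdeal w 1) (hDp : ∀ β, w β = 1 → D β p = 0) :
    p = 0 := by
  classical
  by_contra hp0
  obtain ⟨m₀, hm₀, hmin⟩ := p.support.exists_min_image (Finsupp.weight w)
    (support_nonempty.mpr hp0)
  rw [mem_support_iff] at hm₀
  obtain ⟨k, hk⟩ : ∃ k, Finsupp.weight w m₀ = k + 1 :=
    ⟨_, (Nat.sub_add_cancel (hp _ hm₀)).symm⟩
  set q := weightedHomogeneousComponent w (k + 1) p with hq
  have hqh : IsWeightedHomogeneous w q (k + 1) :=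
    weightedHomogeneousComponent_isWeightedHomogeneous _ _
  have hpk : p ∈ weightIdeal w (k + 1) := fun m hm ↦ hk ▸ hmin m (mem_support_iff.2 hm)
  have hpq : p - q ∈ weightIdeal w (k + 1 + 1) := by
    intro m hm
    rw [coeff_sub, hq, coeff_weightedHomogeneousComponent] at hm
    split_ifs at hm with h
    · simp at hm
    · have := hpk m (by simpa using hm)
      lia
  have hpd (β : τ) (hβ : w β = 1) : pderiv β q = 0 := by
    -- `D β - c β ∂_β` preserves the filtration and `D β p = 0`.
    have h1 : c β * pderiv β p ∈ weightIdeal w (k + 1) := by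
      have := derivation_mem_weightIdeal (D β - c β • pderiv β)
        (fun j ↦ weightIdeal_anti (hw j) (by simpa using hD β hβ j)) hpk
      simpa [hDp β hβ] using this
    -- `p - q` has weight at least `k + 2`, and `∂_β` lowers the weight by at most one.
    have h2 : c β * pderiv β q ∈ weightIdeal w (k + 1) := by
      have := sub_mem h1 (Ideal.mul_mem_left _ (c β) (pderiv_mem_weightIdeal (hw β) hpq))
      simpa [mul_sub] using this
    have h3 := eq_zero_of_mem_weightIdeal (n := 0 + k) (by lia)
      ((hc β hβ).mul (hqh.pderiv (i := β) (n' := k) (by rw [hβ]))) h2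
    exact (mul_eq_zero.1 h3).resolve_left (hc0 β hβ)
  -- Euler's identity expresses `(k + 1) q` through the `∂_β q` with `β` of weight one, all of which
  -- vanish.
  have hsum := hqh.sum_weight_X_mul_pderiv
  rw [Finset.sum_eq_zero fun i _ ↦ ?_, eq_comm, smul_eq_zero] at hsum
  · refine hm₀ ?_
    have := congr_arg (coeff m₀) (hsum.resolve_left (by lia))
    rwa [hq, coeff_weightedHomogeneousComponent, if_pos hk] at this
  · rcases Nat.le_one_iff_eq_zero_or_eq_one.1 (hw i) with h | h
    · rw [h, zero_smul]
    · rw [hpd i h, mul_zero, smul_zero]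

end WeightFiltration

end MvPolynomial

/-! ### Derivations and determinants. -/

section DerivationDet

variable {R S : Type*} [CommRing R] [CommRing S] [Algebra R S]

/-- The ring homomorphism `x ↦ x + ε D x` to the dual numbers. -/
def Derivation.toDualNumber (D : Derivation R S S) : S →+* TrivSqZeroExt S S where
  toFun x := TrivSqZeroExt.inl x + TrivSqZeroExt.inr (D x)
  map_zero' := by simp
  map_one' := by simp
  map_add' x y := by ext <;> simp
  map_mul' x y := by ext <;> simp [mul_comm]

open TrivSqZeroExt in
/-- If a derivation acts on a matrix entrywise as a commutator, then it annihilates the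
determinant. -/
lemma Derivation.map_det_eq_zero_of_commutator {n : Type*} [Fintype n] [DecidableEq n]
    (D : Derivation R S S) (M B : Matrix n n S) (h : M.map D = B * M - M * B) :
    D M.det = 0 := by
  let M' : Matrix n n (TrivSqZeroExt S S) := M.map inl
  let B' : Matrix n n (TrivSqZeroExt S S) := B.map inr
  have hBB : B' * B' = 0 := by
    ext i j <;> simp [B', Matrix.mul_apply]
  have hBM : B' * M' = (B * M).map inr := by
    ext i j <;> simp [B', M', Matrix.mul_apply, fst_sum, snd_sum, mul_comm]
  have hMB : M' * B' = (M * B).map inr := by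
    ext i j <;> simp [B', M', Matrix.mul_apply, fst_sum, snd_sum, mul_comm]
  have hBMB : B' * M' * B' = 0 := by
    rw [hBM]
    ext i j <;> simp [B', Matrix.mul_apply]
  -- Over the dual numbers, `M + ε D M` is the conjugate of `M` by `1 + ε B`, whose inverse is `1 -
  -- ε B`; hence its determinant has no `ε` part.
  have hM : D.toDualNumber.mapMatrix M = (1 + B') * M' * (1 - B') := by
    have : (1 + B') * M' * (1 - B') = M' + (B' * M' - M' * B') - B' * M' * B' := by noncomm_ring
    rw [this, hBMB, hBM, hMB, sub_zero]
    ext i j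
    · simp [toDualNumber, M']
    · simpa [toDualNumber, M'] using congr_arg (fun A : Matrix n n S ↦ A i j) h
  have hdet : D.toDualNumber M.det = M'.det := by
    rw [RingHom.map_det, hM, Matrix.det_mul, Matrix.det_mul, mul_right_comm, ← Matrix.det_mul,
      show (1 + B') * (1 - B') = 1 - B' * B' by noncomm_ring, hBB, sub_zero, Matrix.det_one,
      one_mul]
  have hinl : M'.det = inl M.det := ((inlHom S S).map_det M).symm
  simpa [toDualNumber, hinl] using congr_arg snd hdet

end DerivationDet

end

/-! ### Invariance of characteristic polynomials and restriction to the Cartan subalgebra. -/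

noncomputable section

namespace LieCharPoly

open MvPolynomial LieAlgebra LieModule

section Invariance

variable {L : Type u} [LieRing L] [LieAlgebra ℂ L] {σ : Type*} [Fintype σ]

/-- The derivation of the polynomial ring that fixes `z₀` and sends the generic element
`∑ k, zₖ x k` to `∑ k j, zₖ c k j x j`. -/
def linearDerivation (c : σ → σ → ℂ) :
    Derivation ℂ (MvPolynomial (Option σ) ℂ) (MvPolynomial (Option σ) ℂ) :=
  mkDerivation ℂ fun j ↦ j.elim 0 fun j ↦ ∑ k, C (c k j) * X (some k)

lemma linearDerivation_X_none (c : σ → σ → ℂ) : linearDerivation c (X none) = 0 := by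
  simp [linearDerivation, mkDerivation_X]

lemma linearDerivation_X_some (c : σ → σ → ℂ) (j : σ) :
    linearDerivation c (X (some j)) = ∑ k, C (c k j) * X (some k) := by
  simp [linearDerivation, mkDerivation_X]

/-- The characteristic polynomial of a representation is annihilated by the derivations that come
from the adjoint action. -/
lemma linearDerivation_pencilDet (x : σ → L) (y : L) (c : σ → σ → ℂ)
    (hc : ∀ k, ⁅y, x k⁆ = ∑ j, c k j • x j)
    (V : Type v) [AddCommGroup V] [Module ℂ V] [LieRingModule L V] [LieModule ℂ L V]
    [FiniteDimensional ℂ V] : linearDerivation c (pencilDet x V) = 0 := by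
  let B := Module.finBasis ℂ V
  let A (y : L) := LinearMap.toMatrix B B (toEnd ℂ L V y)
  have hA (k : σ) : A y * A (x k) - A (x k) * A y = ∑ j, c k j • A (x j) := by
    simp only [A, ← LinearMap.toMatrix_mul, ← map_sub, ← map_smul, ← map_sum, ← hc, LieHom.map_lie]
    rfl
  rw [pencilDet_eq_det_pencilMatrix x B]
  refine Derivation.map_det_eq_zero_of_commutator _ _ ((A y).map C) ?_
  have h1 : (A y).map C * pencilMatrix (fun i ↦ A (x i)) -
      pencilMatrix (fun i ↦ A (x i)) * (A y).map C =
      ∑ k, (X (some k) : MvPolynomial (Option σ) ℂ) • (∑ j, c k j • A (x j)).map C := by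
    simp only [pencilMatrix, mul_add, add_mul, Matrix.mul_smul, Matrix.smul_mul, mul_one, one_mul,
      add_sub_add_left_eq_sub, Finset.mul_sum, Finset.sum_mul, ← Finset.sum_sub_distrib,
      ← smul_sub, ← hA]
    refine Finset.sum_congr rfl fun k _ ↦ ?_
    rw [Matrix.map_sub C (by simp), Matrix.map_mul, Matrix.map_mul]
  refine Eq.trans ?_ h1.symm
  ext1 i j
  have h2 (a : ℂ) : linearDerivation c (C a) = 0 := (linearDerivation c).map_algebraMap a
  have h3 : linearDerivation c ((1 : Matrix _ _ (MvPolynomial (Option σ) ℂ)) i j) = 0 := by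
    rw [Matrix.one_apply]; split_ifs <;> simp
  simp only [pencilMatrix, Matrix.map_apply, Matrix.add_apply, Matrix.smul_apply, Matrix.sum_apply,
    smul_eq_mul, map_add, map_sum, Derivation.leibniz, h2, h3, linearDerivation_X_none,
    linearDerivation_X_some, mul_zero, zero_add, Finset.mul_sum, C_mul, A]
  rw [Finset.sum_comm]
  exact Finset.sum_congr rfl fun k _ ↦ Finset.sum_congr rfl fun j _ ↦ by ring

end Invariance

variable {L : Type u} [LieRing L] [LieAlgebra ℂ L] [FiniteDimensional ℂ L] [IsSimple ℂ L]
  {H : LieSubalgebra ℂ L} [H.IsCartanSubalgebra] (b : (IsKilling.rootSystem H).Base)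

lemma span_simpleCoroot : Submodule.span ℂ (Set.range (simpleCoroot b)) = ⊤ := by
  have := b.span_coroot_support (R := ℂ)
  rw [Set.image_eq_range] at this
  exact this.trans RootPairing.IsRootSystem.span_coroot_eq_top

lemma exists_apply_simpleCoroot_ne_zero (β : H.root) :
    ∃ i, β.1 (simpleCoroot b i) ≠ 0 := by
  by_contra! h
  refine H.isNonZero_coe_root β ((Weight.coe_toLinear_eq_zero_iff ..).1 ?_)
  exact LinearMap.ext_on_range (span_simpleCoroot b) fun i ↦ by simpa using h i

/-- Spanning alone yields structure constants; linear independence plays no role. -/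
lemma span_canonicalFamily {e : H.root → L} (he : ∀ α : H.root, e α ∈ rootSpace H α.1)
    (he_ne : ∀ α : H.root, e α ≠ 0) :
    Submodule.span ℂ (Set.range (canonicalFamily b e)) = ⊤ := by
  rw [eq_top_iff, ← LieSubmodule.top_toSubmodule (R := ℂ) (L := H) (M := L),
    ← iSup_genWeightSpace_eq_top' ℂ H L, LieSubmodule.iSup_toSubmodule, iSup_le_iff]
  intro χ x hx
  by_cases hχ : χ.IsZero
  · have hxH : x ∈ H := by
      have hx' : x ∈ rootSpace H (χ : H → ℂ) := hx
      rw [hχ.eq, rootSpace_zero_eq] at hx'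
      exact hx'
    have hxs : (⟨x, hxH⟩ : H) ∈ Submodule.span ℂ (Set.range (simpleCoroot b)) := by
      rw [span_simpleCoroot]; trivial
    have := Submodule.mem_map_of_mem (f := H.toSubmodule.subtype) hxs
    rw [Submodule.map_span, ← Set.range_comp] at this
    refine Submodule.span_mono ?_ this
    rintro _ ⟨i, rfl⟩
    exact ⟨Sum.inl i, rfl⟩
  · let α : H.root := ⟨χ, by simpa using hχ⟩
    obtain ⟨c, hc⟩ := (finrank_eq_one_iff_of_nonzero' (⟨e α, he α⟩ : rootSpace H χ)
      (by simpa using he_ne α)).1 (IsKilling.finrank_rootSpace_eq_one χ hχ) ⟨x, hx⟩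
    have hc' : c • e α = x := congr_arg Subtype.val hc
    rw [← hc']
    exact Submodule.smul_mem _ _ (Submodule.subset_span ⟨Sum.inr α, rfl⟩)

open scoped Classical in
/-- The structure constants of the action of a root vector on the canonical family, normalized on
the simple coroots. -/
lemma exists_structureConstants {e : H.root → L} (he : ∀ α : H.root, e α ∈ rootSpace H α.1)
    (he_ne : ∀ α : H.root, e α ≠ 0) (β : H.root) :
    ∃ c : b.support ⊕ H.root → b.support ⊕ H.root → ℂ,
      (∀ k, ⁅e β, canonicalFamily b e k⁆ = ∑ j, c k j • canonicalFamily b e j) ∧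
      ∀ i, c (Sum.inl i) = Pi.single (Sum.inr β) (-β.1 (simpleCoroot b i)) := by
  have h (α : H.root) := (Submodule.mem_span_range_iff_exists_fun ℂ).1
    ((span_canonicalFamily b he he_ne).ge (Submodule.mem_top (x := ⁅e β, e α⁆)))
  choose c hc using h
  refine ⟨Sum.elim (fun i ↦ Pi.single (Sum.inr β) (-β.1 (simpleCoroot b i))) c, ?_, fun _ ↦ rfl⟩
  rintro (i | α)
  · rw [Finset.sum_eq_single (Sum.inr β) (fun j _ hj ↦ by simp [hj]) (by simp)]
    have := IsKilling.lie_eq_smul_of_mem_rootSpace (he β) (simpleCoroot b i)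
    rw [LieSubalgebra.coe_bracket_of_module] at this
    simp [canonicalFamily, ← this]
  · exact (hc α).symm

/-- The variables that belong to root vectors have weight one, the others have weight zero. -/
def rootWeight : Option (b.support ⊕ H.root) → ℕ
  | some (Sum.inr _) => 1
  | _ => 0

/-- Killing the root variables changes a polynomial only modulo the ideal they generate, as is seen
on variables. -/
lemma mem_weightIdeal_of_linearize_eq_zero
    {p : MvPolynomial (Option (b.support ⊕ H.root)) ℂ} (hp : linearize b p = 0) :
    p ∈ weightIdeal (rootWeight b) 1 := by
  let E := (rename (R := ℂ) (Option.map (Sum.inl : b.support → b.support ⊕ H.root))).comp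
    (linearize b)
  have hE (j) : E (X j) - X j ∈ weightIdeal (rootWeight b) 1 := by
    rcases j with _ | i | α
    · simp [E, linearize]
    · simp [E, linearize]
    · have : X (some (Sum.inr α)) ∈ weightIdeal (R := ℂ) (rootWeight b) 1 :=
        X_mem_weightIdeal (w := rootWeight b) (some (Sum.inr α))
      simpa [E, linearize] using this
  have hEp : E p = 0 := by simp [E, hp]
  clear_value E
  clear hp
  suffices ∀ p, E p - p ∈ weightIdeal (rootWeight b) 1 by
    simpa [hEp] using this p
  intro p
  induction p using MvPolynomial.induction_on with
  | C a => rw [← algebraMap_eq, E.commutes, sub_self]; exact zero_mem _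
  | add p q hp hq =>
    rw [map_add, add_sub_add_comm]
    exact add_mem hp hq
  | mul_X p j hp =>
    have : E (p * X j) - p * X j = E p * (E (X j) - X j) + X j * (E p - p) := by
      rw [map_mul]; ring
    rw [this]
    exact add_mem (Ideal.mul_mem_left _ _ (hE j)) (Ideal.mul_mem_left _ _ hp)

open scoped Classical in
/-- Polynomials that are invariant under the root vectors and have zero restriction to the Cartan
subalgebra vanish. -/
lemma eq_zero_of_linearDerivation_eq_zero
    (c : H.root → b.support ⊕ H.root → b.support ⊕ H.root → ℂ)
    (hc : ∀ β i, c β (Sum.inl i) = Pi.single (Sum.inr β) (-β.1 (simpleCoroot b i)))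
    {p : MvPolynomial (Option (b.support ⊕ H.root)) ℂ}
    (hp : linearize b p = 0) (hcp : ∀ β, linearDerivation (c β) p = 0) : p = 0 := by
  let D : Option (b.support ⊕ H.root) → Derivation ℂ
      (MvPolynomial (Option (b.support ⊕ H.root)) ℂ)
      (MvPolynomial (Option (b.support ⊕ H.root)) ℂ)
    | some (Sum.inr β) => linearDerivation (c β)
    | _ => 0
  -- As `⁅e β, h_i⁆ = -β(h_i) e β`, the Cartan variables enter `D β (z_j)` only for `j = β`, and
  -- there through this linear form.
  let d : Option (b.support ⊕ H.root) → MvPolynomial (Option (b.support ⊕ H.root)) ℂ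
    | some (Sum.inr β) => ∑ i, C (-β.1 (simpleCoroot b i)) * X (some (Sum.inl i))
    | _ => 0
  have hroot {j} (hj : rootWeight b j = 1) : ∃ β, j = some (Sum.inr β) := by
    match j, hj with
    | some (Sum.inr β), _ => exact ⟨β, rfl⟩
  refine eq_zero_of_derivation_eq_zero (w := rootWeight b) ?_ D d ?_ ?_ ?_
    (mem_weightIdeal_of_linearize_eq_zero b hp) ?_
  · rintro (_ | _ | _) <;> simp [rootWeight]
  · intro j hj
    obtain ⟨β, rfl⟩ := hroot hj
    exact IsWeightedHomogeneous.sum _ _ _ fun i _ ↦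
      (isWeightedHomogeneous_X ℂ (rootWeight b) (some (Sum.inl i))).C_mul _
  · intro j hj h0
    obtain ⟨β, rfl⟩ := hroot hj
    obtain ⟨i, hi⟩ := exists_apply_simpleCoroot_ne_zero b β
    have := congr_arg (coeff (Finsupp.single (some (Sum.inl i)) 1)) h0
    simp only [d, coeff_sum, coeff_C_mul, coeff_X, Finsupp.single_left_inj one_ne_zero,
      Option.some_inj, Sum.inl.injEq, mul_ite, mul_one, mul_zero, coeff_zero] at this
    simp [hi] at this
  · intro j hj k
    obtain ⟨β, rfl⟩ := hroot hj
    have hmem (j) : ∑ α : H.root, C (c β (Sum.inr α) j) *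
        (X (some (Sum.inr α)) : MvPolynomial (Option (b.support ⊕ H.root)) ℂ) ∈
        weightIdeal (rootWeight b) 1 :=
      sum_mem fun α _ ↦ Ideal.mul_mem_left _ _
        (X_mem_weightIdeal (R := ℂ) (w := rootWeight b) (some (Sum.inr α)))
    match k with
    | none => simp [D, linearDerivation_X_none]
    | some (Sum.inl i) =>
      simpa [D, linearDerivation_X_some, pderiv_X_of_ne, hc] using hmem (Sum.inl i)
    | some (Sum.inr α) =>
      by_cases h : α = β
      · subst h
        simpa [D, d, linearDerivation_X_some, hc] using hmem (Sum.inr α)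
      · simpa [D, linearDerivation_X_some, pderiv_X_of_ne, hc, h] using hmem (Sum.inr α)
  · intro j hj
    obtain ⟨β, rfl⟩ := hroot hj
    exact hcp β

lemma linearize_charPoly (e : H.root → L) (V : Type v) [AddCommGroup V] [Module ℂ V]
    [LieRingModule L V] [LieModule ℂ L V] [FiniteDimensional ℂ V] :
    linearize b (charPoly b e V) = linCharPoly b V := by
  let B := Module.finBasis ℂ V
  rw [charPoly, linCharPoly, pencilDet_eq_det_pencilMatrix _ B, pencilDet_eq_det_pencilMatrix _ B,
    AlgHom.map_det]
  congr 1
  ext1 i j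
  have h1 : linearize b ((1 : Matrix _ _ (MvPolynomial _ ℂ)) i j) =
      (1 : Matrix _ _ (MvPolynomial _ ℂ)) i j := by
    simp only [Matrix.one_apply]; split_ifs <;> simp
  have h2 (a : ℂ) : linearize b (C a) = C a := (linearize b).commutes a
  simp only [AlgHom.mapMatrix_apply, pencilMatrix, Matrix.map_apply, Matrix.add_apply,
    Matrix.smul_apply, Matrix.sum_apply, smul_eq_mul, map_add, map_mul, map_sum, h1, h2,
    Fintype.sum_sum_type]
  simp [linearize, canonicalFamily]

/-- A characteristic polynomial is determined by its linearization. -/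
lemma charPoly_eq_of_linCharPoly_eq {e : H.root → L}
    (he : ∀ α : H.root, e α ∈ rootSpace H α.1) (he_ne : ∀ α : H.root, e α ≠ 0)
    {V : Type v} [AddCommGroup V] [Module ℂ V] [LieRingModule L V] [LieModule ℂ L V]
    [FiniteDimensional ℂ V]
    {W : Type v} [AddCommGroup W] [Module ℂ W] [LieRingModule L W] [LieModule ℂ L W]
    [FiniteDimensional ℂ W] (h : linCharPoly b V = linCharPoly b W) :
    charPoly b e V = charPoly b e W := by
  choose c hc hc' using exists_structureConstants b he he_ne
  refine sub_eq_zero.1 (eq_zero_of_linearDerivation_eq_zero b c hc' ?_ fun β ↦ ?_)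
  · rw [map_sub, linearize_charPoly, linearize_charPoly, h, sub_self]
  · rw [map_sub, charPoly, charPoly, linearDerivation_pencilDet _ (e β) _ (hc β),
      linearDerivation_pencilDet _ (e β) _ (hc β), sub_self]

/-! ### The bijection `ρ` and the transported monoid structure. -/

lemma CP.exists_eq_of {e : H.root → L} (p : CP.{u, v} b e) :
    ∃ V : FinRep.{u, v} L, p = CP.of b e V.carrier := by
  obtain ⟨p, V, _, _, _, _, _, rfl⟩ := p
  exact ⟨⟨V⟩, rfl⟩

/-- Linearization as a map between sets of characteristic polynomials. -/
def linearizeCP (e : H.root → L) (p : CP.{u, v} b e) : LinCP.{u, v} b :=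
  ⟨linearize b p.1, by
    obtain ⟨p, V, _, _, _, _, _, rfl⟩ := p
    exact ⟨V, _, _, _, _, ‹_›, linearize_charPoly b e V⟩⟩

lemma linearizeCP_of (e : H.root → L) (V : Type v) [AddCommGroup V] [Module ℂ V]
    [LieRingModule L V] [LieModule ℂ L V] [FiniteDimensional ℂ V] :
    linearizeCP b e (CP.of b e V) = LinCP.of b V :=
  Subtype.ext (linearize_charPoly b e V)

lemma linearizeCP_bijective {e : H.root → L} (he : ∀ α : H.root, e α ∈ rootSpace H α.1)
    (he_ne : ∀ α : H.root, e α ≠ 0) : Function.Bijective (linearizeCP.{u, v} b e) := by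
  refine ⟨fun p q hpq ↦ ?_, fun p ↦ ?_⟩
  · obtain ⟨V, rfl⟩ := CP.exists_eq_of b p
    obtain ⟨W, rfl⟩ := CP.exists_eq_of b q
    rw [linearizeCP_of, linearizeCP_of] at hpq
    exact Subtype.ext (charPoly_eq_of_linCharPoly_eq b he he_ne (congr_arg Subtype.val hpq))
  · obtain ⟨V, rfl⟩ := LinCP.exists_eq_of p
    exact ⟨_, linearizeCP_of b e V.carrier⟩

end LieCharPoly

end

/-- The two commutative monoid structures are determined by the listed equations, since every
element of `LinCP b` and of `CP b e` comes from a representation. -/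
theorem theorem4p2 {L : Type u} [LieRing L] [LieAlgebra ℂ L] [FiniteDimensional ℂ L]
    [LieAlgebra.IsSimple ℂ L] (H : LieSubalgebra ℂ L) [H.IsCartanSubalgebra]
    (b : (LieAlgebra.IsKilling.rootSystem H).Base)
    (e : H.root → L) (he : ∀ α : H.root, e α ∈ LieAlgebra.rootSpace H α.1)
    (he_ne : ∀ α : H.root, e α ≠ 0) :
    ∃ (_ : CommMonoid (LieCharPoly.LinCP.{u, v} b)) (_ : CommMonoid (LieCharPoly.CP.{u, v} b e))
      (ρ : LieCharPoly.CP.{u, v} b e ≃* LieCharPoly.LinCP.{u, v} b),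
      -- `ρ` is the linearization map, with `ρ (f_φ)` the linearized polynomial of `φ`
      (∀ p : LieCharPoly.CP.{u, v} b e, (ρ p).1 = LieCharPoly.linearize b p.1) ∧
      (∀ (V : Type v) [AddCommGroup V] [Module ℂ V] [LieRingModule L V] [LieModule ℂ L V]
        [FiniteDimensional ℂ V], ρ (LieCharPoly.CP.of b e V) = LieCharPoly.LinCP.of b V) ∧
      -- the multiplication of linearized polynomials is the resolution product
      (∀ (V : Type v) [AddCommGroup V] [Module ℂ V] [LieRingModule L V] [LieModule ℂ L V]
        [FiniteDimensional ℂ V]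
        (W : Type v) [AddCommGroup W] [Module ℂ W] [LieRingModule L W] [LieModule ℂ L W]
        [FiniteDimensional ℂ W],
        (LieCharPoly.LinCP.of b V * LieCharPoly.LinCP.of b W).1 =
          LieCharPoly.weightProduct b V W) ∧
      (1 : LieCharPoly.LinCP.{u, v} b).1 = MvPolynomial.X none ∧
      -- the multiplication on `CP` is the resolution product, pulled back along `ρ`
      (∀ p q : LieCharPoly.CP.{u, v} b e, p * q = ρ.symm (ρ p * ρ q)) ∧
      (1 : LieCharPoly.CP.{u, v} b e).1 = MvPolynomial.X none ∧
      -- it is compatible with tensor products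
      (∀ (V : Type v) [AddCommGroup V] [Module ℂ V] [LieRingModule L V] [LieModule ℂ L V]
        [FiniteDimensional ℂ V]
        (W : Type v) [AddCommGroup W] [Module ℂ W] [LieRingModule L W] [LieModule ℂ L W]
        [FiniteDimensional ℂ W],
        LieCharPoly.CP.of b e V * LieCharPoly.CP.of b e W =
          LieCharPoly.CP.of b e (V ⊗[ℂ] W)) := by
  have hρ := LieCharPoly.linearizeCP_bijective.{u, v} b he he_ne
  let E := Equiv.ofBijective _ hρ
  let _ : CommMonoid (LieCharPoly.LinCP.{u, v} b) := LieCharPoly.LinCP.commMonoid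
  let _ : CommMonoid (LieCharPoly.CP.{u, v} b e) := E.commMonoid
  let ρ : LieCharPoly.CP.{u, v} b e ≃* LieCharPoly.LinCP.{u, v} b := E.mulEquiv
  have hof (V : Type v) [AddCommGroup V] [Module ℂ V] [LieRingModule L V] [LieModule ℂ L V]
      [FiniteDimensional ℂ V] : ρ (LieCharPoly.CP.of b e V) = LieCharPoly.LinCP.of b V :=
    LieCharPoly.linearizeCP_of b e V
  refine ⟨LieCharPoly.LinCP.commMonoid, E.commMonoid, ρ, fun _ ↦ rfl, hof, ?_, LieCharPoly.LinCP.coe_one,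
    fun p q ↦ ?_, ?_, ?_⟩
  · intro V _ _ _ _ _ W _ _ _ _ _
    rw [LieCharPoly.LinCP.of_mul_of]
    exact LieCharPoly.linCharPoly_tensorProduct_eq_weightProduct b V W
  · rw [← map_mul, MulEquiv.symm_apply_apply]
  · have : (1 : LieCharPoly.CP.{u, v} b e) = LieCharPoly.CP.of b e LieCharPoly.TrivialRep.{v} :=
      ρ.injective ((map_one ρ).trans (hof LieCharPoly.TrivialRep.{v}).symm)
    rw [this]
    exact LieCharPoly.pencilDet_trivialRep _
  · intro V _ _ _ _ _ W _ _ _ _ _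
    apply ρ.injective
    rw [map_mul, hof, hof, hof, LieCharPoly.LinCP.of_mul_of]
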